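/- Let $K$ be a field and let $\mathbb G_m^2=\operatorname{Spec} K[x^{\pm1},y^{\pm1}]$ be the two-dimensional split algebraic torus over $K$. Let $f$ be an automorphism of the $K$-scheme $\mathbb G_m^2$. Using the open embedding $\mathbb G_m^2\subset\mathbb P^2_K$, $(x,y)\mapsto[x:y:1]$, regard the iterates $f^n$ as birational maps of $\mathbb P^2_K$. Suppose that $f$ is loxodromic, i.e. that its dynamical degree $$\lambda(f)=\lim_{n\to\infty}\bigl((f^n)^*H\cdot H\bigr)^{1/n}\qquad(H\subset\mathbb P^2_K\text{ a line})$$ satisfies $\lambda(f)>1$. Here $(f^n)^*H\cdot H$ is the degree of $f^n$, that is, the common degree $d$ of homogeneous polynomials $P_0,P_1,P_2\in K[X_0,X_1,X_2]$ without nonconstant common factor such that $f^n=[P_0:P_1:P_2]$. Then $f$ admits no invariant curve: there is no Zariski closed subset $C\subset\mathbb G_m^2$ of dimension $1$ (irreducible or not) such that $f(C)\subseteq C$. -/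

import Mathlib

open AlgebraicGeometry CategoryTheory Filter Topology

universe u

noncomputable section

namespace Torus

/-- The ring `K[x, x⁻¹, y, y⁻¹]` of Laurent polynomials in two variables, spanned by the monomials
`x ^ i * y ^ j` with `(i, j) : ℤ × ℤ`. -/
abbrev CoordRing (K : Type u) [Field K] : Type u := AddMonoidAlgebra K (ℤ × ℤ)

/-- The coordinate function `x`. -/
def x (K : Type u) [Field K] : CoordRing K := AddMonoidAlgebra.single (1, 0) 1

/-- The coordinate function `y`. -/
def y (K : Type u) [Field K] : CoordRing K := AddMonoidAlgebra.single (0, 1) 1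

/-- The algebraic torus `𝔾ₘ² = Spec K[x, x⁻¹, y, y⁻¹]` as a scheme over `Spec K`. Its automorphisms
as a `K`-scheme are the elements of the group `Aut (Gm2 K)`. -/
def Gm2 (K : Type u) [Field K] : Over (Spec (CommRingCat.of K)) :=
  Over.mk (Spec.map (CommRingCat.ofHom (algebraMap K (CoordRing K))))

variable {K : Type u} [Field K]

/-- The morphism of schemes underlying a `K`-automorphism of `𝔾ₘ²`. -/
def toMor (f : Aut (Gm2 K)) :
    Spec (CommRingCat.of (CoordRing K)) ⟶ Spec (CommRingCat.of (CoordRing K)) :=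
  f.hom.left

/-- The pullback `f^* : K[x, x⁻¹, y, y⁻¹] → K[x, x⁻¹, y, y⁻¹]` of regular functions. On points,
`f = (f^* x, f^* y)`. -/
def pullback (f : Aut (Gm2 K)) : CoordRing K →+* CoordRing K :=
  (Spec.preimage (toMor f)).hom

/-- Embed `𝔾ₘ²` in the projective plane by `(x, y) ↦ [x : y : 1]`. `IsHomogeneousForm f d P` says
that the birational map of `ℙ²` induced by `f` is `[P₀ : P₁ : P₂]`, where `P₀, P₁, P₂` are
homogeneous polynomials of degree `d` in three variables without nonconstant common factor. -/
structure IsHomogeneousForm (f : Aut (Gm2 K)) (d : ℕ)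
    (P : Fin 3 → MvPolynomial (Fin 3) K) : Prop where
  homogeneous : ∀ i, (P i).IsHomogeneous d
  coprime : ∀ q : MvPolynomial (Fin 3) K, (∀ i, q ∣ P i) → IsUnit q
  ne_zero : MvPolynomial.aeval ![x K, y K, 1] (P 2) ≠ 0
  eq_x : MvPolynomial.aeval ![x K, y K, 1] (P 0) =
    pullback f (x K) * MvPolynomial.aeval ![x K, y K, 1] (P 2)
  eq_y : MvPolynomial.aeval ![x K, y K, 1] (P 1) =
    pullback f (y K) * MvPolynomial.aeval ![x K, y K, 1] (P 2)

/-- The intersection number `f^* H · H` on `ℙ²`, for `H` a line. The homogeneous form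
`[P₀ : P₁ : P₂]` of `f` is unique up to a nonzero constant, and if its degree is `d` then `f^* H` is
the class of the plane curve `a P₀ + b P₁ + c P₂ = 0` of degree `d`, so `f^* H = d H` in
`Pic ℙ² = ℤ H`, and `f^* H · H = d` because `H · H = 1`. The set below has exactly one element. -/
def degree (f : Aut (Gm2 K)) : ℕ :=
  sInf {d | ∃ P, IsHomogeneousForm f d P}

/-- `lam` is the dynamical degree of `f`: the limit of `((f ^ n)^* H · H) ^ (1 / n)`. -/
def HasDynamicalDegree (f : Aut (Gm2 K)) (lam : ℝ) : Prop :=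
  Tendsto (fun n : ℕ => (degree (f ^ n) : ℝ) ^ (1 / (n : ℝ))) atTop (𝓝 lam)

/-- `f` is loxodromic: its dynamical degree is greater than `1`. -/
def IsLoxodromic (f : Aut (Gm2 K)) : Prop :=
  ∃ lam : ℝ, HasDynamicalDegree f lam ∧ 1 < lam

/-- A (possibly reducible) algebraic curve in `𝔾ₘ²`: a Zariski closed subset of the scheme `𝔾ₘ²`
of dimension one. -/
structure IsCurve (C : Set (Spec (CommRingCat.of (CoordRing K)))) : Prop where
  isClosed : IsClosed C
  dim_eq_one : topologicalKrullDim C = 1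

/-- `C` is invariant under `f`, that is, `f(C) ⊆ C`. -/
def IsInvariant (f : Aut (Gm2 K)) (C : Set (Spec (CommRingCat.of (CoordRing K)))) : Prop :=
  toMor f '' C ⊆ C

end Torus

end

/-!
The units of `K[x, x⁻¹, y, y⁻¹]` are the monomials, so the pullback by an automorphism `f` of `𝔾ₘ²`
sends each monomial `x ^ m` to a multiple of `x ^ (A m)`, for some invertible endomorphism `A` of
`ℤ²` (`exists_isUnit_isMonomial`).

If `f` is loxodromic, then `A` has no nonzero periodic vector (`IsLoxodromic.pow_apply_ne`). Indeed,
if `A ^ n` fixes a nonzero vector, then `(A ^ n) ^ 2` is unipotent (`pow_apply_of_fixed`), so the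
entries of its powers grow linearly. The degree of a monomial map is bounded by a multiple of the
entries of its matrix (`degree_le`), so the degrees of the iterates of `f` grow at most linearly
along an arithmetic progression, and the dynamical degree is at most `1`.

If `f` preserves a curve, it permutes its finitely many one-dimensional components, so some iterate
of `f` preserves an irreducible curve (`exists_periodic_generic_point`). Its prime ideal is
generated by one Laurent polynomial `h` (`exists_eq_span_of_lt`), and the iterate pulls `h` back to
a unit, hence a monomial, times `h`. The corresponding power of `A` therefore maps the exponents of
`h` into a translate of themselves and permutes the finite set of their differences. As `h` is not a
monomial, some difference is a nonzero periodic vector of `A`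
(`IsMonomial.exists_periodic_of_map_eq`), a contradiction.
-/

namespace Torus

theorem exists_iterate_eq_of_mapsTo {α : Type*} {f : α → α} (hf : Function.Injective f)
    {S : Set α} (hS : S.Finite) (hfS : Set.MapsTo f S S) {a : α} (ha : a ∈ S) :
    ∃ n, 0 < n ∧ f^[n] a = a := by
  obtain ⟨i, j, hij, h⟩ := hS.exists_lt_map_eq_of_forall_mem
    (f := fun n => f^[n] a) (fun n => hfS.iterate n ha)
  refine ⟨j - i, Nat.sub_pos_of_lt hij, hf.iterate i ?_⟩
  rw [← Function.iterate_add_apply, Nat.add_sub_cancel' hij.le]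
  exact h.symm

/-! ### Laurent polynomials and monomial maps -/

section Monomials

variable {K : Type u} [Field K]

open AddMonoidAlgebra in
theorem isUnit_single (m : ℤ × ℤ) {c : K} (hc : c ≠ 0) :
    IsUnit (single m c : CoordRing K) := by
  refine IsUnit.of_mul_eq_one (single (-m) c⁻¹) ?_
  rw [single_mul_single, AddMonoidAlgebra.one_def, add_neg_cancel, mul_inv_cancel₀ hc]

/-- The inclusion `K[X, Y] → K[x, x⁻¹, y, y⁻¹]`. -/
noncomputable def ofPolynomial (K : Type u) [Field K] :
    MvPolynomial (Fin 2) K →ₐ[K] CoordRing K :=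
  MvPolynomial.aeval ![x K, y K]

open AddMonoidAlgebra in
theorem ofPolynomial_monomial (s : Fin 2 →₀ ℕ) (c : K) :
    ofPolynomial K (MvPolynomial.monomial s c) = single ((s 0 : ℤ), (s 1 : ℤ)) c := by
  rw [ofPolynomial, MvPolynomial.aeval_monomial, Finsupp.prod_fintype _ _ (by simp)]
  simp [x, y, single_pow, single_mul_single, AddMonoidAlgebra.coe_algebraMap]

theorem ofPolynomial_injective : Function.Injective (ofPolynomial K) := by
  intro p q h
  have key : ∀ (p : MvPolynomial (Fin 2) K) (s : Fin 2 →₀ ℕ),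
      (ofPolynomial K p).coeff ((s 0 : ℤ), (s 1 : ℤ)) = p.coeff s := by
    intro p s
    induction p using MvPolynomial.induction_on' with
    | monomial t c =>
      rw [ofPolynomial_monomial, AddMonoidAlgebra.coeff_single, Finsupp.single_apply,
        MvPolynomial.coeff_monomial]
      refine if_congr ?_ rfl rfl
      constructor
      · intro h
        ext i
        fin_cases i <;> simp_all
      · rintro rfl; rfl
    | add p q hp hq => simp [hp, hq]
  ext s
  rw [← key, ← key, h]

/-- Clearing denominators: every Laurent polynomial is a polynomial up to a monomial factor. -/
theorem exists_single_mul_eq_ofPolynomial (u : CoordRing K) :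
    ∃ (n : ℕ) (p : MvPolynomial (Fin 2) K),
      AddMonoidAlgebra.single ((n : ℤ), (n : ℤ)) 1 * u = ofPolynomial K p := by
  have step : ∀ (u : CoordRing K) (n k : ℕ) (p : MvPolynomial (Fin 2) K),
      AddMonoidAlgebra.single ((n : ℤ), (n : ℤ)) 1 * u = ofPolynomial K p →
      ∃ q, AddMonoidAlgebra.single (((n + k : ℕ) : ℤ), ((n + k : ℕ) : ℤ)) 1 * u
        = ofPolynomial K q := by
    intro u n k p h
    refine ⟨MvPolynomial.monomial (Finsupp.equivFunOnFinite.symm ![k, k]) 1 * p, ?_⟩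
    rw [map_mul, ← h, ofPolynomial_monomial, ← mul_assoc, AddMonoidAlgebra.single_mul_single]
    simp [add_comm]
  induction u using AddMonoidAlgebra.induction_linear with
  | zero => exact ⟨0, 0, by simp⟩
  | add u v hu hv =>
    obtain ⟨n, p, hp⟩ := hu
    obtain ⟨k, q, hq⟩ := hv
    obtain ⟨p', hp'⟩ := step u n k p hp
    obtain ⟨q', hq'⟩ := step v k n q hq
    refine ⟨n + k, p' + q', ?_⟩
    rw [map_add, ← hp', ← hq', mul_add, add_comm k n]
  | single m c =>
    refine ⟨m.1.natAbs + m.2.natAbs, MvPolynomial.monomial (Finsupp.equivFunOnFinite.symm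
      ![(m.1.natAbs + m.2.natAbs + m.1).toNat, (m.1.natAbs + m.2.natAbs + m.2).toNat]) c, ?_⟩
    rw [ofPolynomial_monomial, AddMonoidAlgebra.single_mul_single, one_mul]
    congr 1
    ext <;> simp only [Finsupp.equivFunOnFinite_symm_apply_apply, Matrix.cons_val_zero,
      Matrix.cons_val_one, Prod.fst_add, Prod.snd_add, Nat.cast_add] <;> omega

/-- The units of the ring of Laurent polynomials are the monomials. -/
theorem exists_eq_single_of_isUnit {u : CoordRing K} (hu : IsUnit u) :
    ∃ m c, c ≠ 0 ∧ u = AddMonoidAlgebra.single m c := by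
  obtain ⟨v, huv⟩ := hu.exists_right_inv
  obtain ⟨n, p, hp⟩ := exists_single_mul_eq_ofPolynomial u
  obtain ⟨k, q, hq⟩ := exists_single_mul_eq_ofPolynomial v
  have hpq : p * q = MvPolynomial.monomial (Finsupp.equivFunOnFinite.symm ![n + k, n + k]) 1 := by
    apply ofPolynomial_injective
    rw [map_mul, ← hp, ← hq, ofPolynomial_monomial, mul_mul_mul_comm, huv,
      AddMonoidAlgebra.single_mul_single]
    simp
  obtain ⟨s, c, -, hc, rfl⟩ :=
    (MvPolynomial.dvd_monomial_iff_exists one_ne_zero).mp (Dvd.intro _ hpq)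
  refine ⟨((s 0 : ℤ), (s 1 : ℤ)) - ((n : ℤ), (n : ℤ)), c, ne_zero_of_dvd_ne_zero one_ne_zero hc, ?_⟩
  rw [ofPolynomial_monomial] at hp
  have : AddMonoidAlgebra.single (-((n : ℤ), (n : ℤ))) (1 : K) *
      AddMonoidAlgebra.single ((n : ℤ), (n : ℤ)) 1 = 1 := by
    rw [AddMonoidAlgebra.single_mul_single, neg_add_cancel, one_mul, AddMonoidAlgebra.one_def]
  rw [← one_mul u, ← this, mul_assoc, hp, AddMonoidAlgebra.single_mul_single, one_mul,
    neg_add_eq_sub]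

/-- `φ` maps each monomial `x ^ m` to a nonzero multiple of `x ^ (A m)`. -/
def IsMonomial (φ : CoordRing K →ₐ[K] CoordRing K) (A : AddMonoid.End (ℤ × ℤ)) : Prop :=
  ∀ m, ∃ c : K, c ≠ 0 ∧ φ (AddMonoidAlgebra.single m 1) = AddMonoidAlgebra.single (A m) c

/-- Every endomorphism of the torus is monomial, because it pulls back units to units. -/
theorem exists_isMonomial (φ : CoordRing K →ₐ[K] CoordRing K) : ∃ A, IsMonomial φ A := by
  have h : ∀ m, ∃ n c, c ≠ 0 ∧ φ (AddMonoidAlgebra.single m 1) = AddMonoidAlgebra.single n c :=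
    fun m => exists_eq_single_of_isUnit ((isUnit_single m one_ne_zero).map φ)
  choose A c hc hA using h
  refine ⟨⟨⟨A, ?_⟩, ?_⟩, fun m => ⟨c m, hc m, hA m⟩⟩
  · have := hA 0
    rw [← AddMonoidAlgebra.one_def, map_one, AddMonoidAlgebra.one_def] at this
    exact (((AddMonoidAlgebra.single_inj.mp this).resolve_right (by simp)).1).symm
  · intro m n
    have := hA (m + n)
    rw [← one_mul (1 : K), ← AddMonoidAlgebra.single_mul_single, map_mul, hA, hA,
      AddMonoidAlgebra.single_mul_single] at this
    exact (((AddMonoidAlgebra.single_inj.mp this).resolve_right (by simp [hc])).1).symm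

namespace IsMonomial

variable {φ ψ : CoordRing K →ₐ[K] CoordRing K} {A B : AddMonoid.End (ℤ × ℤ)}

theorem exists_map_single (h : IsMonomial φ A) (m : ℤ × ℤ) {c : K} (hc : c ≠ 0) :
    ∃ c' : K, c' ≠ 0 ∧
      φ (AddMonoidAlgebra.single m c) = AddMonoidAlgebra.single (A m) c' := by
  obtain ⟨d, hd, h⟩ := h m
  refine ⟨c * d, mul_ne_zero hc hd, ?_⟩
  have : (AddMonoidAlgebra.single m c : CoordRing K) = c • AddMonoidAlgebra.single m 1 := by simp
  rw [this, map_smul, h, AddMonoidAlgebra.smul_single, smul_eq_mul]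

theorem one : IsMonomial (AlgHom.id K (CoordRing K)) 1 := fun _ => ⟨1, one_ne_zero, rfl⟩

theorem comp (hφ : IsMonomial φ A) (hψ : IsMonomial ψ B) : IsMonomial (φ.comp ψ) (A * B) := by
  intro m
  obtain ⟨c, hc, h⟩ := hψ m
  obtain ⟨d, hd, h'⟩ := hφ.exists_map_single (B m) hc
  exact ⟨d, hd, by rw [AlgHom.comp_apply, h, h']; rfl⟩

theorem unique (hA : IsMonomial φ A) (hB : IsMonomial φ B) : A = B := by
  ext1 m
  obtain ⟨c, hc, h⟩ := hA m
  obtain ⟨d, hd, h'⟩ := hB m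
  exact ((AddMonoidAlgebra.single_inj.mp (h.symm.trans h')).resolve_right (by simp [hc])).1

theorem pow (hφ : IsMonomial φ A) (n : ℕ) : IsMonomial (φ ^ n) (A ^ n) := by
  induction n with
  | zero => exact one
  | succ n ih => rw [pow_succ, pow_succ]; exact ih.comp hφ

theorem mem_support_map (h : IsMonomial φ A) (hA : Function.Injective A) {u : CoordRing K}
    {m : ℤ × ℤ} (hm : m ∈ u.coeff.support) : A m ∈ (φ u).coeff.support := by
  choose c hc h using h
  have key : ∀ (u : CoordRing K) (m : ℤ × ℤ), (φ u).coeff (A m) = u.coeff m * c m := by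
    intro u m
    induction u using AddMonoidAlgebra.induction_linear with
    | zero => simp
    | add u v hu hv => simp [hu, hv, add_mul]
    | single n d =>
      have : (AddMonoidAlgebra.single n d : CoordRing K) = d • AddMonoidAlgebra.single n 1 := by
        simp
      rw [this, map_smul, h, AddMonoidAlgebra.smul_single, AddMonoidAlgebra.smul_single]
      simp only [AddMonoidAlgebra.coeff_single, Finsupp.single_apply, hA.eq_iff]
      split_ifs with hnm <;> simp [hnm]
  rw [Finsupp.mem_support_iff] at hm ⊢
  rw [key]
  exact mul_ne_zero hm (hc m)

/-- If `h` is mapped to a monomial multiple of itself, then `A` permutes the finitely many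
differences of exponents of `h`, so these are periodic. A nonunit has at least two exponents. -/
theorem exists_periodic_of_map_eq (hφ : IsMonomial φ A) (hA : Function.Injective A)
    {h : CoordRing K} (h0 : h ≠ 0) (hu : ¬ IsUnit h) {k : ℤ × ℤ} {c : K}
    (hh : φ h = AddMonoidAlgebra.single k c * h) :
    ∃ v : ℤ × ℤ, v ≠ 0 ∧ ∃ n, 0 < n ∧ (A ^ n) v = v := by
  -- A Laurent polynomial with at most one exponent is zero or a unit.
  have hcard : 1 < h.coeff.support.card := by
    by_contra hle
    rw [not_lt, Finsupp.card_support_le_one'] at hle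
    obtain ⟨m, d, hd⟩ := hle
    have hd' : h = AddMonoidAlgebra.single m d := AddMonoidAlgebra.coeff_injective hd
    have : d ≠ 0 := by
      rintro rfl
      simp [hd'] at h0
    exact hu (hd' ▸ isUnit_single m this)
  obtain ⟨m, hm, m', hm', hne⟩ := Finset.one_lt_card.mp hcard
  set D := Set.image2 (· - ·) (h.coeff.support : Set (ℤ × ℤ)) h.coeff.support
  have hD : D.Finite := (Finset.finite_toSet _).image2 _ (Finset.finite_toSet _)
  have hsupp : ∀ n ∈ h.coeff.support, A n - k ∈ h.coeff.support := by
    intro n hn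
    have := hφ.mem_support_map hA hn
    rw [hh, Finsupp.mem_support_iff] at this
    rw [Finsupp.mem_support_iff]
    intro h0
    refine this ?_
    rw [AddMonoidAlgebra.coeff_single_mul_eq_mul_coeff (A n - k), h0, mul_zero]
    intro a _
    rw [eq_sub_iff_add_eq, add_comm]
  have hAD : Set.MapsTo A D D := by
    rintro _ ⟨a, ha, b, hb, rfl⟩
    exact ⟨_, hsupp a ha, _, hsupp b hb, by simp⟩
  obtain ⟨n, hn, hper⟩ := exists_iterate_eq_of_mapsTo hA hD hAD ⟨m, hm, m', hm', rfl⟩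
  exact ⟨m - m', sub_ne_zero.mpr hne, n, hn, by rwa [AddMonoid.End.coe_pow]⟩

end IsMonomial

end Monomials

/-! ### Automorphisms of the torus as monomial maps -/

section Pullback

variable {K : Type u} [Field K]

/-- The pullback of regular functions by an automorphism of `𝔾ₘ²`, as a `K`-algebra
homomorphism. -/
noncomputable def pullbackAlgHom (f : Aut (Gm2 K)) : CoordRing K →ₐ[K] CoordRing K where
  __ := pullback f
  commutes' c := by
    have h : toMor f ≫ Spec.map (CommRingCat.ofHom (algebraMap K (CoordRing K))) =
        Spec.map (CommRingCat.ofHom (algebraMap K (CoordRing K))) := Over.w f.hom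
    rw [← Spec.map_preimage (toMor f), ← Spec.map_comp] at h
    exact congr($(Spec.map_injective h).hom c)

theorem pullbackAlgHom_apply (f : Aut (Gm2 K)) (u : CoordRing K) :
    pullbackAlgHom f u = pullback f u := rfl

theorem pullbackAlgHom_one : pullbackAlgHom (1 : Aut (Gm2 K)) = AlgHom.id K (CoordRing K) := by
  have h : Spec.preimage (toMor (1 : Aut (Gm2 K))) = 𝟙 _ := by
    apply Spec.map_injective
    rw [Spec.map_preimage, Spec.map_id]
    rfl
  refine AlgHom.ext fun m => ?_
  rw [pullbackAlgHom_apply, pullback, h]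
  rfl

theorem pullbackAlgHom_mul (f g : Aut (Gm2 K)) :
    pullbackAlgHom (f * g) = (pullbackAlgHom g).comp (pullbackAlgHom f) := by
  have h : Spec.preimage (toMor (f * g)) =
      Spec.preimage (toMor f) ≫ Spec.preimage (toMor g) := by
    apply Spec.map_injective
    rw [Spec.map_preimage, Spec.map_comp, Spec.map_preimage, Spec.map_preimage]
    rfl
  refine AlgHom.ext fun m => ?_
  rw [pullbackAlgHom_apply, pullback, h]
  rfl

theorem pullbackAlgHom_pow (f : Aut (Gm2 K)) (n : ℕ) :
    pullbackAlgHom (f ^ n) = pullbackAlgHom f ^ n := by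
  induction n with
  | zero => exact pullbackAlgHom_one
  | succ n ih => rw [pow_succ', pullbackAlgHom_mul, ih, pow_succ]; rfl

theorem pullbackAlgHom_surjective (f : Aut (Gm2 K)) :
    Function.Surjective (pullbackAlgHom f) := by
  intro u
  refine ⟨pullbackAlgHom f⁻¹ u, ?_⟩
  rw [← AlgHom.comp_apply, ← pullbackAlgHom_mul, inv_mul_cancel, pullbackAlgHom_one]
  rfl

/-- An automorphism of `𝔾ₘ²` acts on exponents through an invertible endomorphism of `ℤ²`. -/
theorem exists_isUnit_isMonomial (f : Aut (Gm2 K)) :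
    ∃ A, IsUnit A ∧ IsMonomial (pullbackAlgHom f) A := by
  obtain ⟨A, hA⟩ := exists_isMonomial (pullbackAlgHom f)
  obtain ⟨B, hB⟩ := exists_isMonomial (pullbackAlgHom f⁻¹)
  have hAB : A * B = 1 := by
    have := hA.comp hB
    rw [← pullbackAlgHom_mul, inv_mul_cancel, pullbackAlgHom_one] at this
    exact this.unique .one
  have hBA : B * A = 1 := by
    have := hB.comp hA
    rw [← pullbackAlgHom_mul, mul_inv_cancel, pullbackAlgHom_one] at this
    exact this.unique .one
  exact ⟨A, ⟨⟨A, B, hAB, hBA⟩, rfl⟩, hA⟩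

end Pullback

/-! ### The degree of a monomial map -/

section Degree

variable {K : Type u} [Field K]

theorem aeval_monomial (s : Fin 3 →₀ ℕ) (c : K) :
    MvPolynomial.aeval ![x K, y K, 1] (MvPolynomial.monomial s c) =
      AddMonoidAlgebra.single ((s 0 : ℤ), (s 1 : ℤ)) c := by
  rw [MvPolynomial.aeval_monomial, Finsupp.prod_fintype _ _ (by simp)]
  simp [Fin.prod_univ_three, x, y, AddMonoidAlgebra.single_pow,
    AddMonoidAlgebra.single_mul_single, AddMonoidAlgebra.coe_algebraMap]

/-- The least exponent `p` for which `t ^ p * (t ^ a, t ^ c, 1)` has no denominators. -/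
theorem exists_clearing_exponent (a c : ℤ) : ∃ p p₀ p₁ : ℕ, (p₀ : ℤ) = p + a ∧ (p₁ : ℤ) = p + c ∧
    (p = 0 ∨ p₀ = 0 ∨ p₁ = 0) ∧ (p : ℤ) ≤ |a| + |c| := by
  have h₀ := le_abs_self a
  have h₁ := neg_le_abs a
  have h₂ := le_abs_self c
  have h₃ := neg_le_abs c
  obtain ⟨p, hp⟩ := Int.eq_ofNat_of_zero_le (le_max_left 0 (max (-a) (-c)))
  obtain ⟨p₀, hp₀⟩ := Int.eq_ofNat_of_zero_le (a := p + a) (by omega)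
  obtain ⟨p₁, hp₁⟩ := Int.eq_ofNat_of_zero_le (a := p + c) (by omega)
  exact ⟨p, p₀, p₁, hp₀.symm, hp₁.symm, by omega, by omega⟩

/-- The degree of a monomial map is at most linear in its exponents. -/
theorem degree_le (f : Aut (Gm2 K)) {A : AddMonoid.End (ℤ × ℤ)}
    (h : IsMonomial (pullbackAlgHom f) A) :
    (degree f : ℤ) ≤
      2 * (|(A (1, 0)).1| + |(A (1, 0)).2| + |(A (0, 1)).1| + |(A (0, 1)).2|) := by
  obtain ⟨α, hα, hx⟩ := h (1, 0)
  obtain ⟨β, hβ, hy⟩ := h (0, 1)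
  generalize A (1, 0) = m at *
  generalize A (0, 1) = n at *
  obtain ⟨a, b⟩ := m
  obtain ⟨c, d⟩ := n
  -- The exponents of the monomial clearing the denominators of `[αxᵃyᵇ : βxᶜyᵈ : 1]`.
  obtain ⟨p, p₀, p₁, hp₀, hp₁, hp, hp'⟩ := exists_clearing_exponent a c
  obtain ⟨q, q₀, q₁, hq₀, hq₁, hq, hq'⟩ := exists_clearing_exponent b d
  obtain ⟨r, r₀, r₁, hr₀, hr₁, hr, hr'⟩ := exists_clearing_exponent (-(a + b)) (-(c + d))
  let s₀ : Fin 3 →₀ ℕ := Finsupp.equivFunOnFinite.symm ![p₀, q₀, r₀]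
  let s₁ : Fin 3 →₀ ℕ := Finsupp.equivFunOnFinite.symm ![p₁, q₁, r₁]
  let s₂ : Fin 3 →₀ ℕ := Finsupp.equivFunOnFinite.symm ![p, q, r]
  have hform : IsHomogeneousForm f (p + q + r) ![MvPolynomial.monomial s₀ α,
      MvPolynomial.monomial s₁ β, MvPolynomial.monomial s₂ 1] := by
    refine ⟨?_, ?_, ?_, ?_, ?_⟩
    · intro i
      fin_cases i
      all_goals
        refine MvPolynomial.isHomogeneous_monomial _ ?_
        rw [Finsupp.degree_eq_sum, Fin.sum_univ_three]
        simp [s₀, s₁, s₂] <;> omega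
    · intro u hu
      have h₀ : u ∣ MvPolynomial.monomial s₀ α := hu 0
      have h₁ : u ∣ MvPolynomial.monomial s₁ β := hu 1
      have h₂ : u ∣ MvPolynomial.monomial s₂ 1 := hu 2
      obtain ⟨m, e, hm₂, he, rfl⟩ := MvPolynomial.dvd_monomial_one_iff_exists.mp h₂
      have hm₀ := (MvPolynomial.monomial_dvd_monomial.mp h₀).1.resolve_left hα
      have hm₁ := (MvPolynomial.monomial_dvd_monomial.mp h₁).1.resolve_left hβ
      have hm : m = 0 := by
        ext i
        have e₀ := hm₀ i
        have e₁ := hm₁ i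
        have e₂ := hm₂ i
        fin_cases i <;> simp [s₀, s₁, s₂] at e₀ e₁ e₂ ⊢ <;> omega
      rw [hm]
      exact he.map MvPolynomial.C
    · simp [aeval_monomial]
    · have hx' : pullback f (x K) = AddMonoidAlgebra.single (a, b) α := hx
      simp only [Matrix.cons_val, aeval_monomial, hx', AddMonoidAlgebra.single_mul_single, mul_one]
      congr 1
      ext <;> simp [s₀, s₂] <;> omega
    · have hy' : pullback f (y K) = AddMonoidAlgebra.single (c, d) β := hy
      simp only [Matrix.cons_val, aeval_monomial, hy', AddMonoidAlgebra.single_mul_single, mul_one]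
      congr 1
      ext <;> simp [s₁, s₂] <;> omega
  have hle : degree f ≤ p + q + r := Nat.sInf_le ⟨_, hform⟩
  have : (degree f : ℤ) ≤ p + q + r := by exact_mod_cast hle
  refine this.trans ?_
  rw [abs_neg, abs_neg] at hr'
  dsimp only
  linarith [abs_add_le a b, abs_add_le c d]

end Degree

/-! ### Degree growth of the iterates -/

section Growth

theorem end_apply_eq (A : AddMonoid.End (ℤ × ℤ)) (w : ℤ × ℤ) :
    A w = w.1 • A (1, 0) + w.2 • A (0, 1) := by
  rw [← map_zsmul, ← map_zsmul, ← map_add]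
  simp

/-- An invertible endomorphism of `ℤ²` fixing a nonzero vector has a unipotent square, by
Cayley-Hamilton: the square has determinant `1` and hence trace `2`. -/
theorem pow_apply_of_fixed {A : AddMonoid.End (ℤ × ℤ)} (hA : IsUnit A) {v : ℤ × ℤ} (hv : v ≠ 0)
    (hAv : A v = v) (k : ℕ) (w : ℤ × ℤ) :
    ((A ^ 2) ^ k) w = w + k • ((A ^ 2) w - w) := by
  set D := A ^ 2 with hD
  have hdet : (D (1, 0)).1 * (D (0, 1)).2 - (D (0, 1)).1 * (D (1, 0)).2 = 1 := by
    obtain ⟨B, hAB⟩ := hA.exists_right_inv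
    have e₁ : A (B (1, 0)) = (1, 0) := DFunLike.congr_fun hAB _
    have e₂ : A (B (0, 1)) = (0, 1) := DFunLike.congr_fun hAB _
    have d₁ : D (1, 0) = A (A (1, 0)) := by rw [hD, pow_two]; rfl
    have d₂ : D (0, 1) = A (A (0, 1)) := by rw [hD, pow_two]; rfl
    rw [d₁, d₂, end_apply_eq A (A (1, 0)), end_apply_eq A (A (0, 1))]
    rw [end_apply_eq A] at e₁ e₂
    generalize A (1, 0) = a at *
    generalize A (0, 1) = b at *
    generalize B (1, 0) = a' at *
    generalize B (0, 1) = b' at *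
    simp only [Prod.ext_iff, Prod.fst_add, Prod.snd_add, Prod.smul_fst, Prod.smul_snd,
      smul_eq_mul] at e₁ e₂ ⊢
    have hunit : (a.1 * b.2 - b.1 * a.2) * (a'.1 * b'.2 - b'.1 * a'.2) = 1 := by
      obtain ⟨e11, e12⟩ := e₁
      obtain ⟨e21, e22⟩ := e₂
      have : (a.1 * b.2 - b.1 * a.2) * (a'.1 * b'.2 - b'.1 * a'.2) =
        (a'.1 * a.1 + a'.2 * b.1) * (b'.1 * a.2 + b'.2 * b.2) -
        (a'.1 * a.2 + a'.2 * b.2) * (b'.1 * a.1 + b'.2 * b.1) := by ring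
      rw [this, e11, e12, e21, e22]; norm_num
    have hsq := Int.isUnit_mul_self (IsUnit.of_mul_eq_one _ hunit)
    linear_combination hsq
  have hDv : D v = v := by rw [hD, pow_two]; exact (congrArg A hAv).trans hAv
  have htr : (D (1, 0)).1 + (D (0, 1)).2 = 2 := by
    rw [end_apply_eq D, Prod.ext_iff] at hDv
    simp only [Prod.fst_add, Prod.snd_add, Prod.smul_fst, Prod.smul_snd, smul_eq_mul] at hDv
    obtain ⟨h₁, h₂⟩ := hDv
    by_cases hv₁ : v.1 = 0
    · have hv₂ : v.2 ≠ 0 := fun h => hv (Prod.ext hv₁ h)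
      apply mul_left_cancel₀ hv₂
      linear_combination (D (1, 0)).2 * h₁ - ((D (1, 0)).1 - 1) * h₂ + v.2 * hdet
    · apply mul_left_cancel₀ hv₁
      linear_combination (D (0, 1)).1 * h₂ - ((D (0, 1)).2 - 1) * h₁ + v.1 * hdet
  have hDD : ∀ w, D (D w) - D w = D w - w := by
    intro w
    rw [end_apply_eq D (D w), end_apply_eq D w]
    generalize D (1, 0) = a at *
    generalize D (0, 1) = b at *
    ext
    · simp only [Prod.fst_add, Prod.fst_sub, Prod.snd_add, Prod.smul_fst, Prod.smul_snd,
        smul_eq_mul]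
      linear_combination (w.1 * a.1 + w.2 * b.1) * htr - w.1 * hdet
    · simp only [Prod.fst_add, Prod.snd_sub, Prod.snd_add, Prod.smul_fst, Prod.smul_snd,
        smul_eq_mul]
      linear_combination (w.1 * a.2 + w.2 * b.2) * htr - w.2 * hdet
  induction k generalizing w with
  | zero => simp
  | succ k ih =>
    rw [pow_succ]
    change (D ^ k) (D w) = _
    rw [ih, hDD, succ_nsmul]
    abel

variable {K : Type u} [Field K]

/-- The action of a loxodromic automorphism on exponents has no periodic vector: the degrees of
the iterates would grow at most linearly along an arithmetic progression. -/
theorem IsLoxodromic.pow_apply_ne {f : Aut (Gm2 K)} (hf : IsLoxodromic f)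
    {A : AddMonoid.End (ℤ × ℤ)} (hA : IsUnit A) (h : IsMonomial (pullbackAlgHom f) A)
    {v : ℤ × ℤ} (hv : v ≠ 0) {n : ℕ} (hn : 0 < n) : (A ^ n) v ≠ v := by
  intro hfix
  obtain ⟨lam, hlim, hlam⟩ := hf
  obtain ⟨μ, hμ, hμlam⟩ := exists_between hlam
  set E := (A ^ n) ^ 2
  obtain ⟨C, hC⟩ : ∃ C : ℕ, ∀ k : ℕ, (degree (f ^ (n * 2 * k)) : ℝ) ≤ C + C * k := by
    set a := E (1, 0)
    set b := E (0, 1)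
    refine ⟨(4 + 2 * (|a.1 - 1| + |a.2| + |b.1| + |b.2 - 1|)).toNat, fun k => ?_⟩
    have hk : IsMonomial (pullbackAlgHom (f ^ (n * 2 * k))) (E ^ k) := by
      rw [pullbackAlgHom_pow, ← pow_mul, ← pow_mul, ← mul_assoc]
      exact h.pow _
    have hd := degree_le _ hk
    rw [pow_apply_of_fixed (hA.pow n) hv hfix, pow_apply_of_fixed (hA.pow n) hv hfix] at hd
    have hbound : (degree (f ^ (n * 2 * k)) : ℤ) ≤
        (4 + 2 * (|a.1 - 1| + |a.2| + |b.1| + |b.2 - 1|)) +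
        (4 + 2 * (|a.1 - 1| + |a.2| + |b.1| + |b.2 - 1|)) * k := by
      refine hd.trans ?_
      change 2 * (|1 + k • (a.1 - 1)| + |0 + k • (a.2 - 0)| + |0 + k • (b.1 - 0)| +
        |1 + k • (b.2 - 1)|) ≤ _
      simp only [nsmul_eq_mul, zero_add, sub_zero, abs_mul, Nat.abs_cast]
      have e₁ := abs_add_le 1 (k * (a.1 - 1))
      have e₂ := abs_add_le 1 (k * (b.2 - 1))
      rw [abs_mul, Nat.abs_cast, abs_one] at e₁ e₂
      have := abs_nonneg (a.1 - 1)
      have := abs_nonneg a.2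
      have := abs_nonneg b.1
      have := abs_nonneg (b.2 - 1)
      have : (0 : ℤ) ≤ k := Int.natCast_nonneg k
      linarith
    rw [← Int.toNat_of_nonneg (a := 4 + 2 * (|a.1 - 1| + |a.2| + |b.1| + |b.2 - 1|))
      (by positivity)] at hbound
    exact_mod_cast hbound
  -- Eventually `degree (f ^ m) > μ ^ m`, which is exponential in `m`.
  have hlow : ∀ᶠ m : ℕ in atTop, μ ^ m < (degree (f ^ m) : ℝ) := by
    filter_upwards [hlim.eventually_const_lt hμlam, eventually_gt_atTop 0] with m hm hm0
    have := pow_lt_pow_left₀ hm (by linarith) hm0.ne'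
    rwa [← Real.rpow_natCast _ m, ← Real.rpow_natCast _ m, ← Real.rpow_mul (Nat.cast_nonneg _),
      one_div_mul_cancel (by exact_mod_cast hm0.ne'), Real.rpow_one, Real.rpow_natCast] at this
  have hseq : Tendsto (fun k : ℕ => n * 2 * k) atTop atTop :=
    tendsto_id.const_mul_atTop' (by positivity)
  have hμ' : 1 < μ ^ (n * 2) := one_lt_pow₀ hμ (by positivity)
  -- The linear upper bound is negligible compared with the exponential lower bound.
  have hzero : Tendsto (fun k : ℕ => C * ((k : ℝ) ^ 0 / (μ ^ (n * 2)) ^ k) +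
      C * ((k : ℝ) ^ 1 / (μ ^ (n * 2)) ^ k)) atTop (𝓝 (C * 0 + C * 0)) :=
    ((tendsto_pow_const_div_const_pow_of_one_lt 0 hμ').const_mul _).add
      ((tendsto_pow_const_div_const_pow_of_one_lt 1 hμ').const_mul _)
  simp only [mul_zero, add_zero, pow_zero, pow_one] at hzero
  obtain ⟨k, hk₁, hk₂⟩ := ((hzero.eventually_lt_const one_pos).and (hseq.eventually hlow)).exists
  have hpos : 0 < (μ ^ (n * 2)) ^ k := by positivity
  rw [← mul_div_assoc, ← mul_div_assoc, ← add_div, div_lt_one hpos, mul_one] at hk₁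
  rw [pow_mul] at hk₂
  linarith [hC k]

end Growth

/-! ### Curves in the torus and their generic points -/

section Primes

variable {K : Type u} [Field K]

/-- Contraction along the localization `K[X, Y] → K[x, x⁻¹, y, y⁻¹]` is strictly monotone. -/
theorem comap_ofPolynomial_strictMono {P Q : Ideal (CoordRing K)} (hPQ : P < Q) :
    P.comap (ofPolynomial K) < Q.comap (ofPolynomial K) := by
  obtain ⟨u, huQ, huP⟩ := SetLike.exists_of_lt hPQ
  obtain ⟨n, p, hp⟩ := exists_single_mul_eq_ofPolynomial u
  refine SetLike.lt_iff_le_and_exists.mpr ⟨Ideal.comap_mono hPQ.le, p, ?_, ?_⟩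
  · rw [Ideal.mem_comap, ← hp]
    exact Q.mul_mem_left _ huQ
  · rw [Ideal.mem_comap, ← hp,
      Ideal.unit_mul_mem_iff_mem _ (isUnit_single _ one_ne_zero)]
    exact huP

/-- In the two-dimensional factorial ring `K[X, Y]`, a nonzero prime that is not maximal is
principal. -/
theorem exists_eq_span_singleton_of_lt {P Q : Ideal (MvPolynomial (Fin 2) K)} [hP : P.IsPrime]
    [hQ : Q.IsPrime] (h0 : P ≠ ⊥) (hPQ : P < Q) : ∃ p, P = Ideal.span {p} := by
  obtain ⟨p, hpP, hp⟩ := hP.exists_mem_prime_of_ne_bot h0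
  refine ⟨p, ?_⟩
  by_contra hne
  have hspan : (Ideal.span {p}).IsPrime := (Ideal.span_singleton_prime hp.ne_zero).mpr hp
  have hlt : Ideal.span {p} < P :=
    lt_of_le_of_ne ((Ideal.span_singleton_le_iff_mem _).mpr hpP) (Ne.symm hne)
  have hbot : (⊥ : Ideal (MvPolynomial (Fin 2) K)) < Ideal.span {p} :=
    bot_lt_iff_ne_bot.mpr (by simpa using hp.ne_zero)
  let c : LTSeries (PrimeSpectrum (MvPolynomial (Fin 2) K)) :=
    ⟨3, ![⟨⊥, Ideal.isPrime_bot⟩, ⟨Ideal.span {p}, hspan⟩, ⟨P, hP⟩, ⟨Q, hQ⟩], by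
      intro i
      fin_cases i
      exacts [hbot, hlt, hPQ]⟩
  have hdim := Order.LTSeries.length_le_krullDim c
  change ((3 : ℕ) : WithBot ℕ∞) ≤ ringKrullDim _ at hdim
  rw [MvPolynomial.ringKrullDim_of_isNoetherianRing, ringKrullDim_eq_zero_of_field, zero_add,
    Nat.card_eq_fintype_card, Fintype.card_fin] at hdim
  exact absurd (by exact_mod_cast hdim : 3 ≤ 2) (by norm_num)

/-- An irreducible curve in `𝔾ₘ²` is defined by a single equation. -/
theorem exists_eq_span_of_lt {P Q : Ideal (CoordRing K)} [P.IsPrime] [Q.IsPrime]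
    (h0 : P ≠ ⊥) (hPQ : P < Q) : ∃ h, P = Ideal.span {h} := by
  have hbot := comap_ofPolynomial_strictMono (bot_lt_iff_ne_bot.mpr h0)
  obtain ⟨p, hp⟩ := exists_eq_span_singleton_of_lt (P := P.comap (ofPolynomial K))
    (bot_le.trans_lt hbot).ne' (comap_ofPolynomial_strictMono hPQ)
  refine ⟨ofPolynomial K p, le_antisymm (fun u hu => ?_) ?_⟩
  · obtain ⟨n, q, hq⟩ := exists_single_mul_eq_ofPolynomial u
    have hqP : q ∈ P.comap (ofPolynomial K) := by
      rw [Ideal.mem_comap, ← hq]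
      exact P.mul_mem_left _ hu
    rw [hp, Ideal.mem_span_singleton] at hqP
    rw [← Ideal.unit_mul_mem_iff_mem _ (isUnit_single ((n : ℤ), (n : ℤ)) (one_ne_zero (α := K))),
      hq, Ideal.mem_span_singleton]
    exact map_dvd _ hqP
  · rw [Ideal.span_singleton_le_iff_mem, ← Ideal.mem_comap, hp]
    exact Ideal.mem_span_singleton_self p

/-- The torus contains a chain of irreducible closed subsets of length two. -/
theorem exists_prime_chain (K : Type u) [Field K] :
    ∃ P Q : PrimeSpectrum (CoordRing K), ⊥ < P ∧ P < Q := by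
  -- The kernels of the restrictions to the subtorus `y = 1` and to the point `x = y = 1`.
  let α : CoordRing K →+* AddMonoidAlgebra K ℤ :=
    AddMonoidAlgebra.mapDomainRingHom K (AddMonoidHom.fst ℤ ℤ)
  let β : AddMonoidAlgebra K ℤ →+* AddMonoidAlgebra K Unit :=
    AddMonoidAlgebra.mapDomainRingHom K (0 : ℤ →+ Unit)
  have hα : ∀ m c, α (AddMonoidAlgebra.single m c) = AddMonoidAlgebra.single m.1 c := by
    simp [α]
  have hβ : ∀ m c, β (AddMonoidAlgebra.single m c) = AddMonoidAlgebra.single () c := by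
    simp [β, -LaurentPolynomial.single_eq_C_mul_T]
  have := NoZeroDivisors.to_isDomain (AddMonoidAlgebra K ℤ)
  have := NoZeroDivisors.to_isDomain (AddMonoidAlgebra K Unit)
  refine ⟨⟨RingHom.ker α, RingHom.ker_isPrime α⟩,
    ⟨RingHom.ker (β.comp α), RingHom.ker_isPrime _⟩, ?_, ?_⟩
  · change (⊥ : Ideal _) < RingHom.ker α
    refine SetLike.lt_iff_le_and_exists.mpr ⟨bot_le,
      AddMonoidAlgebra.single (0, 1) 1 - AddMonoidAlgebra.single (0, 0) 1, ?_, ?_⟩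
    · rw [RingHom.mem_ker, map_sub, hα, hα, sub_self]
    · rw [Ideal.mem_bot, sub_eq_zero, AddMonoidAlgebra.single_inj]
      simp
  · change RingHom.ker α < RingHom.ker (β.comp α)
    refine SetLike.lt_iff_le_and_exists.mpr ⟨?_,
      AddMonoidAlgebra.single (1, 0) 1 - AddMonoidAlgebra.single (0, 0) 1, ?_, ?_⟩
    · rw [← RingHom.comap_ker]
      exact Ideal.comap_mono bot_le
    · rw [RingHom.mem_ker, RingHom.comp_apply, map_sub, hα, hα, map_sub, hβ, hβ, sub_self]
    · rw [RingHom.mem_ker, map_sub, hα, hα, sub_eq_zero, AddMonoidAlgebra.single_inj]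
      simp

/-- Let `C` be a one-dimensional closed subset of `Spec R`, for `R` noetherian. The points of `C`
having a proper specialization are generic points of irreducible components, so there are finitely
many of them, and an injective strictly monotone self-map preserving `C` permutes them. Hence one of
them is periodic. The first conjunct says that `C` contains no chain of length two. -/
theorem exists_periodic_generic_point {R : Type*} [CommRing R] [IsNoetherianRing R]
    {C : Set (PrimeSpectrum R)} (hC : IsClosed C) (hdim : topologicalKrullDim C = 1)
    {g : PrimeSpectrum R → PrimeSpectrum R} (hg : StrictMono g) (hinj : Function.Injective g)
    (hgC : Set.MapsTo g C C) :
    (∀ P ∈ C, ∀ Q ∈ C, ∀ Q', P < Q → ¬ Q < Q') ∧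
      ∃ P ∈ C, (∃ Q, P < Q) ∧ ∃ n, 0 < n ∧ g^[n] P = P := by
  obtain ⟨I, rfl⟩ := (PrimeSpectrum.isClosed_iff_zeroLocus_ideal C).mp hC
  have hsurj := Ideal.Quotient.mk_surjective (I := I)
  have hup : ∀ {P Q : PrimeSpectrum R}, P ∈ PrimeSpectrum.zeroLocus (I : Set R) → P ≤ Q →
      Q ∈ PrimeSpectrum.zeroLocus (I : Set R) := fun hP hPQ => Set.Subset.trans hP hPQ
  have hkrull : Order.krullDim (PrimeSpectrum.zeroLocus (I : Set R)) = 1 := by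
    have e := (PrimeSpectrum.isClosedEmbedding_comap_of_surjective _ _ hsurj).isEmbedding
    have hrange : Set.range (PrimeSpectrum.comap (Ideal.Quotient.mk I)) =
        PrimeSpectrum.zeroLocus (I : Set R) := by
      rw [range_comap_of_surjective _ _ hsurj, Ideal.mk_ker]
    rw [← ringKrullDim_quotient, ← PrimeSpectrum.topologicalKrullDim_eq_ringKrullDim,
      ← hdim, ← hrange]
    exact IsHomeomorph.topologicalKrullDim_eq _ e.toHomeomorph.isHomeomorph
  have hchain : ∀ P ∈ PrimeSpectrum.zeroLocus (I : Set R),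
      ∀ Q ∈ PrimeSpectrum.zeroLocus (I : Set R), ∀ Q', P < Q → ¬ Q < Q' := by
    intro P hP Q hQ Q' hPQ hQQ'
    rcases Order.krullDim_le_one_iff.mp hkrull.le ⟨Q, hQ⟩ with h | h
    · exact hPQ.not_ge (h (b := ⟨P, hP⟩) hPQ.le)
    · exact hQQ'.not_ge (h (b := ⟨Q', hup hQ hQQ'.le⟩) hQQ'.le)
  refine ⟨hchain, ?_⟩
  let S := {P ∈ PrimeSpectrum.zeroLocus (I : Set R) | ∃ Q, P < Q}
  have hS : S.Finite := by
    refine Set.Finite.of_finite_image (f := PrimeSpectrum.asIdeal)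
      (I.finite_minimalPrimes_of_isNoetherianRing R |>.subset ?_)
      (fun _ _ _ _ h => PrimeSpectrum.ext h)
    rintro _ ⟨P, ⟨hP, Q, hPQ⟩, rfl⟩
    refine ⟨⟨P.2, hP⟩, fun J hJ hJP => ?_⟩
    by_contra hle
    exact hchain ⟨J, hJ.1⟩ hJ.2 P hP Q (lt_of_le_not_ge hJP hle) hPQ
  obtain ⟨P, Q, hPQ⟩ := Order.one_le_krullDim_iff.mp hkrull.ge
  have hPS : P.1 ∈ S := ⟨P.2, Q.1, hPQ⟩
  have hgS : Set.MapsTo g S S := fun P ⟨hP, Q, hPQ⟩ => ⟨hgC hP, g Q, hg hPQ⟩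
  exact ⟨P.1, P.2, ⟨Q.1, hPQ⟩, exists_iterate_eq_of_mapsTo hinj hS hgS hPS⟩

end Primes

end Torus

/-! ### Absence of invariant curves -/

open Torus in
theorem corollary5p3 {K : Type u} [Field K] (f : Aut (Torus.Gm2 K)) (hf : Torus.IsLoxodromic f) :
    ¬ ∃ C : Set (Spec (CommRingCat.of (Torus.CoordRing K))),
      Torus.IsCurve C ∧ Torus.IsInvariant f C := by
  rintro ⟨C, hC, hinv⟩
  obtain ⟨A, hA, hφ⟩ := exists_isUnit_isMonomial f
  set φ := pullbackAlgHom f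
  let g : PrimeSpectrum (CoordRing K) → PrimeSpectrum (CoordRing K) :=
    PrimeSpectrum.comap (φ : CoordRing K →+* CoordRing K)
  have hg : ∀ P, toMor f P = g P := by
    intro P
    rw [← Spec.map_preimage (toMor f)]
    rfl
  have hinj : Function.Injective g :=
    PrimeSpectrum.comap_injective_of_surjective _ (pullbackAlgHom_surjective f)
  have hmono : StrictMono g :=
    Monotone.strictMono_of_injective (fun P Q h => Ideal.comap_mono h) hinj
  have hgC : Set.MapsTo g C C := fun P hP => hg P ▸ hinv ⟨P, hP, rfl⟩
  have : IsNoetherianRing (CoordRing K) := Algebra.FiniteType.isNoetherianRing K _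
  obtain ⟨hchain, P, hPC, ⟨Q, hPQ⟩, n, hn, hper⟩ :=
    exists_periodic_generic_point (R := CoordRing K) hC.isClosed hC.dim_eq_one hmono hinj hgC
  have hP0 : P.asIdeal ≠ ⊥ := by
    intro h
    -- If `P` were the generic point of the torus, `C` would be the whole surface.
    obtain ⟨P₁, P₂, h₁, h₂⟩ := exists_prime_chain K
    have hP : P = ⊥ := PrimeSpectrum.ext h
    have hPC₁ : P₁ ∈ C := ((PrimeSpectrum.le_iff_specializes P P₁).mp (hP ▸ bot_le)).mem_closed
      hC.isClosed hPC
    exact hchain P hPC P₁ hPC₁ P₂ (hP ▸ h₁) h₂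
  obtain ⟨h, hh⟩ := exists_eq_span_of_lt hP0 hPQ
  have hiter : ∀ k (R : PrimeSpectrum (CoordRing K)),
      (g^[k] R).asIdeal = R.asIdeal.comap (φ ^ k) := by
    intro k
    induction k with
    | zero => intro R; rfl
    | succ k ih =>
      intro R
      rw [Function.iterate_succ_apply, ih, pow_succ']
      rfl
  have hcomap : P.asIdeal.comap (φ ^ n) = P.asIdeal := by rw [← hiter, hper]
  -- The equation `h` of an invariant irreducible curve is an eigenfunction up to a unit.
  have hspan : Ideal.span {h} = Ideal.span {(φ ^ n) h} := by
    have hsurj : Function.Surjective (φ ^ n) :=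
      pullbackAlgHom_pow f n ▸ pullbackAlgHom_surjective (f ^ n)
    rw [← Ideal.map_comap_of_surjective (φ ^ n) hsurj (Ideal.span {h}), ← hh, hcomap, hh,
      Ideal.map_span, Set.image_singleton]
  obtain ⟨u, hu⟩ := Ideal.span_singleton_eq_span_singleton.mp hspan
  obtain ⟨k, c, -, hk⟩ := exists_eq_single_of_isUnit u.isUnit
  have hAn : Function.Injective (A ^ n) := by
    obtain ⟨B, hB⟩ := (hA.pow n).exists_left_inv
    exact Function.LeftInverse.injective (g := B) fun w => DFunLike.congr_fun hB w
  obtain ⟨v, hv, m, hm, hvm⟩ := (hφ.pow n).exists_periodic_of_map_eq hAn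
    (by rintro rfl; simp [hh] at hP0)
    (fun hunit => P.2.ne_top (hh.trans (Ideal.span_singleton_eq_top.mpr hunit)))
    (by rw [← hk, mul_comm, hu])
  rw [← pow_mul] at hvm
  exact hf.pow_apply_ne hA hφ hv (Nat.mul_pos hn hm) hvm
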